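/- **Theorem 3.5.** Let $\mathcal A$ and $\mathcal B$ be abelian categories with enough projective and enough injective objects, and let $(\mathcal B,\mathcal A,i,e,l)$ be a cleft extension of $\mathcal B$: functors $i:\mathcal B\to\mathcal A$, $e:\mathcal A\to\mathcal B$, $l:\mathcal B\to\mathcal A$ such that $e$ is faithful and exact, $l$ is left adjoint to $e$, and $ei\cong \mathrm{Id}_{\mathcal B}$. Let $G:\mathcal A\to\mathcal A$ be the functor $G(A)=\ker(\mu_A: le(A)\to A)$, where $\mu$ is the counit of $(l,e)$, let $F=eGi:\mathcal B\to\mathcal B$ (an additive functor), with left derived functors $\mathbb L_tF$, and let $q:\mathcal A\to\mathcal B$ be the left adjoint of $i$ (which exists for every cleft extension). For an integer $n\ge 0$, an object $X$ of one of these categories is called *partial $n$-tilting* if (T1) $\operatorname{pd}X\le n$ and (T2) $\operatorname{Ext}^j(X,X)=0$ for all $j\ge 1$. It is called *$n$-tilting* if in addition (T3) for every projective object $P$ there is an exact sequence $0\to P\to X_0\to\cdots\to X_n\to 0$ with each $X_j\in\operatorname{Add}X$, where $\operatorname{Add}X$ is the class of direct summands of (existing) set-indexed coproducts of copies of $X$.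 Write $X^{\perp_n}=\{Y:\operatorname{Ext}^j(X,Y)=0\text{ for all }1\le j\le n\}$. Let $n\ge 0$ and let $X\in\mathcal B$ be such that $\mathbb L_tF(X)=0$ for all $1\le t\le n+1$. Then: 1. $l(X)$ is partial $n$-tilting if and only if $X$ is partial $n$-tilting and $F(X)\in X^{\perp_n}$. 2. If $\operatorname{Ker}q=0$, that is, if every object $A$ of $\mathcal A$ with $q(A)=0$ is zero, then $l(X)$ is $n$-tilting if and only if $X$ is $n$-tilting and $F(X)\in X^{\perp_n}$. -/

import Mathlib

open CategoryTheory CategoryTheory.Limits CategoryTheory.Abelian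

universe w v v₁ v₂ u u₁ u₂

section Tilting

variable {C : Type u} [Category.{v} C] [Abelian C] [EnoughProjectives C]

/-- `Ext^j(X, Y) = 0`, where `Ext^j` is Mathlib's Yoneda Ext group (which is a `v`-small group
because there are enough projectives). -/
def ExtVanishes (X Y : C) (j : ℕ) : Prop :=
  haveI : HasExt.{v} C := hasExt_of_enoughProjectives.{v} C
  Subsingleton (Ext.{v} X Y j)

/-- `Y ∈ X^{⊥_n}`: `Ext^j(X, Y) = 0` for all `1 ≤ j ≤ n`. -/
def InPerp (X : C) (n : ℕ) (Y : C) : Prop :=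
  ∀ j : ℕ, 1 ≤ j → j ≤ n → ExtVanishes X Y j

/-- `Y ∈ Add X`: `Y` is a direct summand of a coproduct `X^{(J)}` of copies of `X`,
indexed by some set `J`. -/
def InAdd {C : Type u} [Category.{v} C] (X Y : C) : Prop :=
  ∃ (J : Type w) (c : Cofan (fun _ : J => X)),
    Nonempty (IsColimit c) ∧ Nonempty (Retract Y c.pt)

/-- There is an exact sequence `0 → P → X₀ → ⋯ → Xₙ → 0` with all `Xⱼ` in `Add X`, written as an
acyclic cochain complex `K` with `K⁰ ≅ P`, `K^{j+1} = Xⱼ` for `j ≤ n`, and `0` afterwards. -/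
def HasAddCoresolution {C : Type u} [Category.{v} C] [Abelian C] (n : ℕ) (X P : C) : Prop :=
  ∃ K : CochainComplex C ℕ, K.Acyclic ∧ Nonempty (K.X 0 ≅ P) ∧
    (∀ j : ℕ, j ≤ n → InAdd.{w} X (K.X (j + 1))) ∧ (∀ j : ℕ, n < j → IsZero (K.X (j + 1)))

/-- Partial `n`-tilting objects: (T1) `pd X ≤ n` and (T2) `Ext^j(X, X) = 0` for all `j ≥ 1`. -/
structure IsPartialTilting (n : ℕ) (X : C) : Prop where
  pd_le : projectiveDimension X ≤ n
  ext_self : ∀ j : ℕ, 1 ≤ j → ExtVanishes X X j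

/-- `n`-tilting objects: partial `n`-tilting objects such that (T3) every projective object `P`
has an exact sequence `0 → P → X₀ → ⋯ → Xₙ → 0` with all `Xⱼ` in `Add X`. -/
structure IsTilting (n : ℕ) (X : C) : Prop extends IsPartialTilting n X where
  coresolution : ∀ P : C, Projective P → HasAddCoresolution.{w} n X P

end Tilting

/-- A cleft extension `(B, A, i, e, l)` of the abelian category `B`: functors `i : B ⥤ A`,
`e : A ⥤ B`, `l : B ⥤ A` with `e` faithful exact, `l` left adjoint to `e`, and `e ∘ i ≅ Id`. -/
structure CleftExtension (B : Type u₁) [Category.{v₁} B] [Abelian B]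
    (A : Type u₂) [Category.{v₂} A] [Abelian A] where
  i : B ⥤ A
  e : A ⥤ B
  l : B ⥤ A
  adj : l ⊣ e
  faithful_e : e.Faithful
  preservesFiniteLimits_e : PreservesFiniteLimits e
  preservesFiniteColimits_e : PreservesFiniteColimits e
  iso : i ⋙ e ≅ 𝟭 B

namespace CleftExtension

variable {B : Type u₁} [Category.{v₁} B] [Abelian B] {A : Type u₂} [Category.{v₂} A] [Abelian A]
  (E : CleftExtension B A)

instance : E.e.Faithful := E.faithful_e

instance : PreservesFiniteLimits E.e := E.preservesFiniteLimits_e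

instance : PreservesFiniteColimits E.e := E.preservesFiniteColimits_e

/-- The endofunctor `G` of `A`, with `G(A) = ker (μ_A : l e A ⟶ A)`, `μ` the counit of `l ⊣ e`. -/
noncomputable def G : A ⥤ A where
  obj Y := kernel (E.adj.counit.app Y)
  map f := kernel.map _ _ (E.l.map (E.e.map f)) f (E.adj.counit.naturality f).symm
  map_id Y := by ext; simp
  map_comp f g := by ext; simp

/-- The inclusion `G ⟶ l e`, which is a kernel of the counit. -/
noncomputable def ι : E.G ⟶ E.e ⋙ E.l where
  app Y := kernel.ι (E.adj.counit.app Y)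
  naturality _ _ _ := kernel.lift_ι _ _ _

instance mono_ι (Y : A) : Mono (E.ι.app Y) :=
  inferInstanceAs (Mono (kernel.ι (E.adj.counit.app Y)))

/-- The endofunctor `F = e G i` of `B`. -/
noncomputable def F : B ⥤ B := E.i ⋙ E.G ⋙ E.e

instance additive_e : E.e.Additive := Functor.additive_of_preserves_binary_products _

instance additive_l : E.l.Additive := E.adj.left_adjoint_additive

instance additive_i : E.i.Additive where
  map_add {X Y f g} := by
    apply E.e.map_injective
    rw [E.e.map_add]
    have h (k : X ⟶ Y) : E.e.map (E.i.map k) = E.iso.hom.app X ≫ k ≫ E.iso.inv.app Y := by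
      have := E.iso.hom.naturality k
      simp only [Functor.comp_map, Functor.id_map] at this
      rw [← Category.assoc, ← this]
      simp
    simp [h]

instance additive_G : E.G.Additive where
  map_add {X Y f g} := by
    have h (k : X ⟶ Y) : E.G.map k ≫ E.ι.app Y = E.ι.app X ≫ E.l.map (E.e.map k) :=
      E.ι.naturality k
    rw [← cancel_mono (E.ι.app Y), Preadditive.add_comp, h, h, h, E.e.map_add, E.l.map_add,
      Preadditive.comp_add]

instance additive_F : E.F.Additive := by
  unfold F
  infer_instance

instance isRightAdjoint_i : E.i.IsRightAdjoint := by
  have : (E.i ⋙ E.e).IsRightAdjoint := ⟨𝟭 B, ⟨Adjunction.id.ofNatIsoRight E.iso.symm⟩⟩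
  have hepi (Y : A) : Epi (E.adj.counit.app Y) := inferInstance
  exact isRightAdjoint_triangle_lift E.i E.adj
    (fun Y => regularEpiOfEpi (E.adj.counit.app Y))

/-- The functor `q : A ⥤ B`, the left adjoint of `i`. -/
noncomputable def q : A ⥤ B := E.i.leftAdjoint

/-- `Ker q = 0`: every object `Y` of `A` with `q(Y) = 0` is zero. -/
def KerQEqZero : Prop := ∀ Y : A, IsZero (E.q.obj Y) → IsZero Y

end CleftExtension

/-! ### Vanishing of Ext and dimension shifting. -/

section ExtVanishing

variable {C : Type u} [Category.{v} C] [Abelian C] [EnoughProjectives C]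

/-! Let P be a projective resolution of X. The sequence 0 → F → e l e i → e i → 0 and e i ≅ Id show
that e l(P) is exact wherever P and F(P) are; then so is l(P), because e is faithful and exact. The
vanishing of the derived functors of F thus makes l(P) a projective resolution of l(X) through
degree n + 1, so Ext^t(l X, Y) and Ext^t(X, e Y) vanish together for 1 ≤ t ≤ n + 1
(`extVanishes_l_iff`). Degree n + 1 compares projective dimensions, since every Z is e i Z up to
isomorphism; degrees up to n compare self-extensions, since e l X ≅ X ⊕ F X.

For (T3), l sends coresolutions of projectives of B to A, and q sends them back because q l ≅ Id.
Exactness survives because Ext(X, e I) and Ext(l X, i I) vanish for injective I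
(`acyclic_map_of_extVanishes`). When Ker q = 0, every projective Q of A is l(q Q) up to isomorphism
(`nonempty_iso_l_q`). -/

lemma ExtVanishes.of_retract {X X' Y : C} {j : ℕ} (r : Retract X X') (h : ExtVanishes X' Y j) :
    ExtVanishes X Y j := by
  have : HasExt.{v} C := hasExt_of_enoughProjectives.{v} C
  have : Subsingleton (Ext.{v} X' Y j) := h
  refine subsingleton_of_forall_eq 0 fun x => ?_
  rw [← x.mk₀_id_comp, ← r.retract, ← Ext.mk₀_comp_mk₀, Ext.comp_assoc_of_second_deg_zero,
    Subsingleton.elim ((Ext.mk₀ r.r).comp x (zero_add j)) 0, Ext.comp_zero]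

lemma ExtVanishes.of_retract_right {X Y Y' : C} {j : ℕ} (r : Retract Y Y')
    (h : ExtVanishes X Y' j) : ExtVanishes X Y j := by
  have : HasExt.{v} C := hasExt_of_enoughProjectives.{v} C
  have : Subsingleton (Ext.{v} X Y' j) := h
  refine subsingleton_of_forall_eq 0 fun x => ?_
  rw [← x.comp_mk₀_id, ← r.retract, ← Ext.mk₀_comp_mk₀, ← Ext.comp_assoc_of_second_deg_zero,
    Subsingleton.elim (x.comp (Ext.mk₀ r.i) (add_zero j)) 0, Ext.zero_comp]

lemma extVanishes_of_projective (X Y : C) [Projective X] {j : ℕ} (hj : 1 ≤ j) :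
    ExtVanishes X Y j := by
  have : HasExt.{v} C := hasExt_of_enoughProjectives.{v} C
  obtain ⟨j, rfl⟩ := Nat.exists_eq_add_of_le' hj
  exact Ext.subsingleton_of_projective X Y j

lemma extVanishes_of_injective (X Y : C) [Injective Y] {j : ℕ} (hj : 1 ≤ j) :
    ExtVanishes X Y j := by
  have : HasExt.{v} C := hasExt_of_enoughProjectives.{v} C
  obtain ⟨j, rfl⟩ := Nat.exists_eq_add_of_le' hj
  exact Ext.subsingleton_of_injective X Y j

lemma extVanishes_of_isZero {X : C} (h : IsZero X) (Y : C) (j : ℕ) : ExtVanishes X Y j := by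
  have : HasExt.{v} C := hasExt_of_enoughProjectives.{v} C
  refine subsingleton_of_forall_eq 0 fun x => ?_
  rw [← x.mk₀_id_comp, h.eq_of_src (𝟙 X) 0, Ext.mk₀_zero, Ext.zero_comp]

section ShortExact

variable {S : ShortComplex C} (hS : S.ShortExact)
include hS

lemma ExtVanishes.left_third {Y : C} {j : ℕ} (h₁ : ExtVanishes S.X₁ Y j)
    (h₂ : ExtVanishes S.X₂ Y (j + 1)) : ExtVanishes S.X₃ Y (j + 1) := by
  have : HasExt.{v} C := hasExt_of_enoughProjectives.{v} C
  have : Subsingleton (Ext.{v} S.X₁ Y j) := h₁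
  have : Subsingleton (Ext.{v} S.X₂ Y (j + 1)) := h₂
  refine subsingleton_of_forall_eq 0 fun x => ?_
  obtain ⟨y, rfl⟩ := Ext.contravariant_sequence_exact₃ hS Y x (Subsingleton.elim _ _)
    (add_comm 1 j)
  rw [Subsingleton.elim y 0, Ext.comp_zero]

lemma ExtVanishes.left_first {Y : C} {j : ℕ} (h₂ : ExtVanishes S.X₂ Y j)
    (h₃ : ExtVanishes S.X₃ Y (j + 1)) : ExtVanishes S.X₁ Y j := by
  have : HasExt.{v} C := hasExt_of_enoughProjectives.{v} C
  have : Subsingleton (Ext.{v} S.X₂ Y j) := h₂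
  have : Subsingleton (Ext.{v} S.X₃ Y (j + 1)) := h₃
  refine subsingleton_of_forall_eq 0 fun x => ?_
  obtain ⟨y, rfl⟩ := Ext.contravariant_sequence_exact₁ hS Y x (add_comm 1 j)
    (Subsingleton.elim _ _)
  rw [Subsingleton.elim y 0, Ext.comp_zero]

lemma ExtVanishes.right_middle {X : C} {j : ℕ} (h₁ : ExtVanishes X S.X₁ j)
    (h₃ : ExtVanishes X S.X₃ j) : ExtVanishes X S.X₂ j := by
  have : HasExt.{v} C := hasExt_of_enoughProjectives.{v} C
  have : Subsingleton (Ext.{v} X S.X₁ j) := h₁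
  have : Subsingleton (Ext.{v} X S.X₃ j) := h₃
  refine subsingleton_of_forall_eq 0 fun x => ?_
  obtain ⟨y, rfl⟩ := Ext.covariant_sequence_exact₂ X hS x (Subsingleton.elim _ _)
  rw [Subsingleton.elim y 0, Ext.zero_comp]

lemma ExtVanishes.right_first {X : C} {j : ℕ} (h₃ : ExtVanishes X S.X₃ j)
    (h₂ : ExtVanishes X S.X₂ (j + 1)) : ExtVanishes X S.X₁ (j + 1) := by
  have : HasExt.{v} C := hasExt_of_enoughProjectives.{v} C
  have : Subsingleton (Ext.{v} X S.X₃ j) := h₃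
  have : Subsingleton (Ext.{v} X S.X₂ (j + 1)) := h₂
  refine subsingleton_of_forall_eq 0 fun x => ?_
  obtain ⟨y, rfl⟩ := Ext.covariant_sequence_exact₁ X hS x (Subsingleton.elim _ _) rfl
  rw [Subsingleton.elim y 0, Ext.zero_comp]

lemma ExtVanishes.right_third {X : C} {j : ℕ} (h₂ : ExtVanishes X S.X₂ j)
    (h₁ : ExtVanishes X S.X₁ (j + 1)) : ExtVanishes X S.X₃ j := by
  have : HasExt.{v} C := hasExt_of_enoughProjectives.{v} C
  have : Subsingleton (Ext.{v} X S.X₂ j) := h₂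
  have : Subsingleton (Ext.{v} X S.X₁ (j + 1)) := h₁
  refine subsingleton_of_forall_eq 0 fun x => ?_
  obtain ⟨y, rfl⟩ := Ext.covariant_sequence_exact₃ X hS x rfl (Subsingleton.elim _ _)
  rw [Subsingleton.elim y 0, Ext.zero_comp]

lemma extVanishes_one_of_extends {Y : C} (h₂ : ExtVanishes S.X₂ Y 1)
    (h : ∀ f : S.X₁ ⟶ Y, ∃ g : S.X₂ ⟶ Y, S.f ≫ g = f) : ExtVanishes S.X₃ Y 1 := by
  have : HasExt.{v} C := hasExt_of_enoughProjectives.{v} C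
  have : Subsingleton (Ext.{v} S.X₂ Y 1) := h₂
  refine subsingleton_of_forall_eq 0 fun x => ?_
  obtain ⟨y, rfl⟩ := Ext.contravariant_sequence_exact₃ hS Y x (Subsingleton.elim _ _)
    (add_zero 1)
  obtain ⟨f, rfl⟩ := Ext.mk₀_bijective _ _ |>.surjective y
  obtain ⟨g, rfl⟩ := h f
  rw [← Ext.mk₀_comp_mk₀, hS.extClass_comp_assoc]

lemma ExtVanishes.extends {Y : C} (h : ExtVanishes S.X₃ Y 1) (f : S.X₁ ⟶ Y) :
    ∃ g : S.X₂ ⟶ Y, S.f ≫ g = f := by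
  have : HasExt.{v} C := hasExt_of_enoughProjectives.{v} C
  have : Subsingleton (Ext.{v} S.X₃ Y 1) := h
  obtain ⟨y, hy⟩ := Ext.contravariant_sequence_exact₁ hS Y (Ext.mk₀ f) (add_zero 1)
    (Subsingleton.elim _ _)
  obtain ⟨g, rfl⟩ := Ext.mk₀_bijective _ _ |>.surjective y
  exact ⟨g, (Ext.mk₀_bijective _ _).injective (by rw [← hy, Ext.mk₀_comp_mk₀])⟩

lemma extVanishes_one_of_lifts {X : C} (h₂ : ExtVanishes X S.X₂ 1)
    (h : ∀ f : X ⟶ S.X₃, ∃ g : X ⟶ S.X₂, g ≫ S.g = f) : ExtVanishes X S.X₁ 1 := by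
  have : HasExt.{v} C := hasExt_of_enoughProjectives.{v} C
  have : Subsingleton (Ext.{v} X S.X₂ 1) := h₂
  refine subsingleton_of_forall_eq 0 fun x => ?_
  obtain ⟨y, rfl⟩ := Ext.covariant_sequence_exact₁ X hS x (Subsingleton.elim _ _) (zero_add 1)
  obtain ⟨f, rfl⟩ := Ext.mk₀_bijective _ _ |>.surjective y
  obtain ⟨g, rfl⟩ := h f
  rw [← Ext.mk₀_comp_mk₀, Ext.comp_assoc_of_second_deg_zero, hS.comp_extClass, Ext.comp_zero]

lemma ExtVanishes.lifts {X : C} (h : ExtVanishes X S.X₁ 1) (f : X ⟶ S.X₃) :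
    ∃ g : X ⟶ S.X₂, g ≫ S.g = f := by
  have : HasExt.{v} C := hasExt_of_enoughProjectives.{v} C
  have : Subsingleton (Ext.{v} X S.X₁ 1) := h
  obtain ⟨y, hy⟩ := Ext.covariant_sequence_exact₃ X hS (Ext.mk₀ f) (zero_add 1)
    (Subsingleton.elim _ _)
  obtain ⟨g, rfl⟩ := Ext.mk₀_bijective _ _ |>.surjective y
  exact ⟨g, (Ext.mk₀_bijective _ _).injective (by rw [← hy, Ext.mk₀_comp_mk₀])⟩

end ShortExact

lemma extVanishes_of_projectiveDimension_le {X : C} {n : ℕ} (h : projectiveDimension X ≤ n)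
    (Y : C) {j : ℕ} (hj : n < j) : ExtVanishes X Y j := by
  have : HasExt.{v} C := hasExt_of_enoughProjectives.{v} C
  rw [projectiveDimension_le_iff] at h
  exact HasProjectiveDimensionLT.subsingleton X (n + 1) _ hj Y

variable [EnoughInjectives C]

omit [EnoughProjectives C] in
lemma exists_shortExact_injective (Y : C) :
    ∃ S : ShortComplex C, S.ShortExact ∧ S.X₁ = Y ∧ Injective S.X₂ :=
  ⟨_, { exact := ShortComplex.exact_cokernel (Injective.ι Y) }, rfl,
    inferInstanceAs (Injective (Injective.under Y))⟩

/-- Coproducts need not be exact, but with enough injectives `Ext` turns those that exist into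
products. -/
lemma extVanishes_of_isColimit_cofan {J : Type w} {X : J → C} {c : Cofan X} (hc : IsColimit c)
    {Y : C} {j : ℕ} (hj : 1 ≤ j) (h : ∀ a, ExtVanishes (X a) Y j) :
    ExtVanishes c.pt Y j := by
  induction j, hj using Nat.le_induction generalizing Y with
  | base =>
    obtain ⟨S, hS, rfl, hI⟩ := exists_shortExact_injective Y
    -- In degree one, vanishing is a lifting property of maps out of the coproduct, which is solved
    -- on each summand.
    refine extVanishes_one_of_lifts hS (extVanishes_of_injective _ _ le_rfl) fun f => ?_
    choose g hg using fun a => (h a).lifts hS (c.inj a ≫ f)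
    exact ⟨Cofan.IsColimit.desc hc g, Cofan.IsColimit.hom_ext hc _ _ fun a => by
      simp [hg]⟩
  | succ j hj ih =>
    obtain ⟨S, hS, rfl, hI⟩ := exists_shortExact_injective Y
    refine .right_first hS (ih fun a => ?_) (extVanishes_of_injective _ _ (by lia))
    exact .right_third hS (extVanishes_of_injective _ _ hj) (h a)

lemma InAdd.extVanishes {X Z Y : C} (hZ : InAdd.{w} X Z) {j : ℕ} (hj : 1 ≤ j)
    (h : ExtVanishes X Y j) : ExtVanishes Z Y j := by
  obtain ⟨J, c, ⟨hc⟩, ⟨r⟩⟩ := hZ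
  exact (extVanishes_of_isColimit_cofan hc hj fun _ => h).of_retract r

/-- One degree suffices: embedding `Y` in an injective shifts higher degrees down to `n + 1`. -/
lemma projectiveDimension_le_iff_extVanishes (X : C) (n : ℕ) :
    projectiveDimension X ≤ n ↔ ∀ Y : C, ExtVanishes X Y (n + 1) := by
  have : HasExt.{v} C := hasExt_of_enoughProjectives.{v} C
  rw [projectiveDimension_le_iff]
  refine ⟨fun _ Y => HasProjectiveDimensionLT.subsingleton X (n + 1) _ le_rfl Y, fun h => ?_⟩
  exact hasProjectiveDimensionLT_of_enoughInjectives X (n + 1) h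

end ExtVanishing

/-! ### Images of exact complexes under a left adjoint. -/

section Complexes

variable {B : Type u₁} [Category.{v₁} B] [Abelian B] {A : Type u₂} [Category.{v₂} A] [Abelian A]
  {α : Type*} {c : ComplexShape α}

/-- Every morphism `K.X i ⟶ Y` that vanishes on boundaries factors through `d : K.X i ⟶ K.X j`:
the complex `Hom(K, Y)` is exact at `i`. -/
def HomologicalComplex.ExtendsAlong (K : HomologicalComplex B c) (i j : α) (Y : B) : Prop :=
  ∀ f : K.X i ⟶ Y, (∀ k, K.d k i ≫ f = 0) → ∃ g : K.X j ⟶ Y, K.d i j ≫ g = f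

omit [Abelian A] [Abelian B] in
lemma CategoryTheory.Adjunction.map_comp_eq_iff {L : B ⥤ A} {R : A ⥤ B} (adj : L ⊣ R) {X X' : B}
    {Y : A} (u : X ⟶ X') (g : L.obj X' ⟶ Y) (f : L.obj X ⟶ Y) :
    L.map u ≫ g = f ↔ u ≫ adj.homEquiv _ _ g = adj.homEquiv _ _ f := by
  rw [← adj.homEquiv_naturality_left, (adj.homEquiv _ _).apply_eq_iff_eq]

lemma HomologicalComplex.extendsAlong_map_iff {L : B ⥤ A} {R : A ⥤ B} (adj : L ⊣ R) [L.Additive]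
    (K : HomologicalComplex B c) (i j : α) (Y : A) :
    ((L.mapHomologicalComplex c).obj K).ExtendsAlong i j Y ↔ K.ExtendsAlong i j (R.obj Y) := by
  have : R.Additive := adj.right_adjoint_additive
  have hzero (X : B) : adj.homEquiv X Y 0 = 0 := by simp [adj.homEquiv_unit]
  constructor
  · intro h f hf
    obtain ⟨f, rfl⟩ := (adj.homEquiv _ _).surjective f
    obtain ⟨g, hg⟩ := h f fun k =>
      (adj.map_comp_eq_iff _ _ _).2 ((hf k).trans (hzero _).symm)
    exact ⟨adj.homEquiv _ _ g, (adj.map_comp_eq_iff _ _ _).1 hg⟩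
  · intro h f hf
    obtain ⟨g, hg⟩ := h (adj.homEquiv _ _ f) fun k =>
      ((adj.map_comp_eq_iff _ _ _).1 (hf k)).trans (hzero _)
    obtain ⟨g, rfl⟩ := (adj.homEquiv _ _).surjective g
    exact ⟨g, (adj.map_comp_eq_iff _ _ _).2 hg⟩

lemma HomologicalComplex.mono_fromOpcycles_iff (K : HomologicalComplex B c) {i j : α}
    (hij : c.Rel i j) : Mono (K.fromOpcycles i j) ↔ K.ExactAt i := by
  rw [K.exactAt_iff_isZero_homology]
  have hl := K.homologyIsKernel i j (c.next_eq' hij)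
  refine ⟨fun _ => ?_, fun h => Preadditive.mono_of_isZero_kernel' _ hl h⟩
  have : K.homologyι i = 0 := by
    rw [← cancel_mono (K.fromOpcycles i j), K.homologyι_comp_fromOpcycles, zero_comp]
  exact IsZero.of_mono_eq_zero _ this

/-- In a projective resolution the opcycles are the syzygies; dimensions are shifted along this
sequence. -/
lemma HomologicalComplex.shortExact_opcycles (K : HomologicalComplex B c) {i j : α}
    (hij : c.Rel i j) (hK : K.ExactAt i) :
    (ShortComplex.mk (K.fromOpcycles i j) (K.pOpcycles j) (by
      simp [← cancel_epi (K.pOpcycles i)])).ShortExact where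
  exact := by
    have h := ShortComplex.exact_of_g_is_cokernel
      (.mk (K.d i j) (K.pOpcycles j) (by simp)) (K.opcyclesIsCokernel i j (c.prev_eq' hij))
    let φ : ShortComplex.mk (K.d i j) (K.pOpcycles j) (by simp) ⟶
        ShortComplex.mk (K.fromOpcycles i j) (K.pOpcycles j)
          (by simp [← cancel_epi (K.pOpcycles i)]) :=
      { τ₁ := K.pOpcycles i, τ₂ := 𝟙 _, τ₃ := 𝟙 _ }
    have : Epi φ.τ₁ := inferInstanceAs (Epi (K.pOpcycles i))
    have : IsIso φ.τ₂ := inferInstanceAs (IsIso (𝟙 (K.X j)))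
    have : Mono φ.τ₃ := inferInstanceAs (Mono (𝟙 (K.opcycles j)))
    exact (ShortComplex.exact_iff_of_epi_of_isIso_of_mono φ).1 h
  mono_f := (K.mono_fromOpcycles_iff hij).2 hK
  epi_g := inferInstanceAs (Epi (K.pOpcycles j))

/-- Extending an embedding of the opcycles into an injective along `d` forces `K.fromOpcycles i j`
to be mono. -/
lemma HomologicalComplex.exactAt_of_extendsAlong [EnoughInjectives B]
    (K : HomologicalComplex B c) {i j : α} (hij : c.Rel i j)
    (h : ∀ I : B, Injective I → K.ExtendsAlong i j I) : K.ExactAt i := by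
  obtain ⟨g, hg⟩ := h _ inferInstance (K.pOpcycles i ≫ Injective.ι (K.opcycles i)) (by simp)
  have hι : K.fromOpcycles i j ≫ g = Injective.ι _ := by
    simp [← cancel_epi (K.pOpcycles i), hg]
  exact (K.mono_fromOpcycles_iff hij).1 (mono_of_mono_fac hι)

variable [EnoughProjectives B] [EnoughProjectives A]

/-- Maps from `K.X i` that kill boundaries are maps from `K.opcycles i`; the obstruction to
extending them to `K.X j` lies in Ext¹ of the next opcycles. -/
lemma HomologicalComplex.extVanishes_opcycles_one_iff (K : HomologicalComplex B c) {i j : α}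
    (hij : c.Rel i j) (hK : K.ExactAt i) {Y : B} (h : ExtVanishes (K.X j) Y 1) :
    ExtVanishes (K.opcycles j) Y 1 ↔ K.ExtendsAlong i j Y := by
  have hS := K.shortExact_opcycles hij hK
  constructor
  · intro h f hf
    obtain ⟨g, hg⟩ := h.extends hS (K.descOpcycles f _ rfl (hf _))
    refine ⟨g, ?_⟩
    rw [← K.p_fromOpcycles i j, Category.assoc]
    exact (congrArg _ hg).trans (by simp)
  · intro h'
    refine extVanishes_one_of_extends hS h fun f => ?_
    obtain ⟨g, hg⟩ := h' (K.pOpcycles i ≫ f) (by simp)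
    exact ⟨g, by simp [← cancel_epi (K.pOpcycles i), hg]⟩

lemma HomologicalComplex.extVanishes_opcycles_succ_iff (K : HomologicalComplex B c) {i j : α}
    (hij : c.Rel i j) (hK : K.ExactAt i) [Projective (K.X j)] {Y : B} {t : ℕ} (ht : 1 ≤ t) :
    ExtVanishes (K.opcycles j) Y (t + 1) ↔ ExtVanishes (K.opcycles i) Y t := by
  have hS := K.shortExact_opcycles hij hK
  exact ⟨fun h => .left_first hS (extVanishes_of_projective (K.X j) Y ht) h,
    fun h => .left_third hS h (extVanishes_of_projective (K.X j) Y (by lia))⟩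

variable {L : B ⥤ A} {R : A ⥤ B} (adj : L ⊣ R) [L.Additive]
include adj

/-- Dimension shifting lowers `t` and raises `j` with `t + j` fixed, using exactness in degrees at
most `t + j`. At `t = 1` both sides are extension problems, which the adjunction identifies. -/
lemma extVanishes_opcycles_map_iff [R.PreservesEpimorphisms] (K : ChainComplex B ℕ)
    [∀ j, Projective (K.X j)] (hK : ∀ j, 1 ≤ j → K.ExactAt j) {m : ℕ}
    (hLK : ∀ j, 1 ≤ j → j ≤ m → ((L.mapHomologicalComplex _).obj K).ExactAt j)
    (Y : A) {t : ℕ} (ht : 1 ≤ t) {j : ℕ} (hj : t + j ≤ m) :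
    ExtVanishes (((L.mapHomologicalComplex _).obj K).opcycles j) Y t ↔
      ExtVanishes (K.opcycles j) (R.obj Y) t := by
  have hproj (j : ℕ) : Projective (((L.mapHomologicalComplex _).obj K).X j) :=
    adj.map_projective _ inferInstance
  have hrel : (ComplexShape.down ℕ).Rel (j + 1) j := rfl
  induction t, ht using Nat.le_induction generalizing j with
  | base =>
    rw [HomologicalComplex.extVanishes_opcycles_one_iff _ hrel (hLK _ (by lia) (by lia))
        (extVanishes_of_projective _ _ le_rfl),
      HomologicalComplex.extVanishes_opcycles_one_iff _ hrel (hK _ (by lia))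
        (extVanishes_of_projective _ _ le_rfl),
      HomologicalComplex.extendsAlong_map_iff adj]
  | succ t ht ih =>
    rw [HomologicalComplex.extVanishes_opcycles_succ_iff _ hrel (hLK _ (by lia) (by lia)) ht,
      HomologicalComplex.extVanishes_opcycles_succ_iff _ hrel (hK _ (by lia)) ht]
    exact ih (by lia) rfl

lemma extVanishes_leftAdjoint_iff [R.PreservesEpimorphisms] {X : B} (P : ProjectiveResolution X)
    {m : ℕ} (hP : ∀ j, 1 ≤ j → j ≤ m → ((L.mapHomologicalComplex _).obj P.complex).ExactAt j)
    (Y : A) {t : ℕ} (ht : 1 ≤ t) (htm : t ≤ m) :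
    ExtVanishes (L.obj X) Y t ↔ ExtVanishes X (R.obj Y) t := by
  have : PreservesColimitsOfSize.{0, 0} L := adj.leftAdjoint_preservesColimits
  have key := extVanishes_opcycles_map_iff adj P.complex
    (fun j hj => by obtain ⟨j, rfl⟩ := Nat.exists_eq_add_of_le' hj
                    exact P.complex_exactAt_succ j) hP Y ht (j := 0) htm
  -- The zeroth opcycles recover `X` and `L.obj X`, as `L` preserves cokernels.
  let e₁ : P.complex.opcycles 0 ≅ X := IsColimit.coconePointUniqueUpToIso
    (P.complex.opcyclesIsCokernel 1 0 (by simp)) P.isColimitCokernelCofork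
  let e₂ : ((L.mapHomologicalComplex _).obj P.complex).opcycles 0 ≅ L.obj X :=
    IsColimit.coconePointUniqueUpToIso
      (((L.mapHomologicalComplex _).obj P.complex).opcyclesIsCokernel 1 0 (by simp))
      (P.cokernelCofork.mapIsColimit P.isColimitCokernelCofork L)
  exact ⟨fun h => (key.1 (h.of_retract e₂.retract)).of_retract e₁.symm.retract,
    fun h => (key.2 (h.of_retract e₁.retract)).of_retract e₂.symm.retract⟩

omit [EnoughProjectives A] in
lemma acyclic_map_of_extVanishes [EnoughInjectives A] (K : CochainComplex B ℕ) (hK : K.Acyclic)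
    {n : ℕ} (hn : ∀ j, n < j → IsZero (K.X (j + 1)))
    (h : ∀ j, ∀ I : A, Injective I → ∀ t, 1 ≤ t → ExtVanishes (K.X (j + 1)) (R.obj I) t) :
    ((L.mapHomologicalComplex _).obj K).Acyclic := by
  have hrel (j : ℕ) : (ComplexShape.up ℕ).Rel j (j + 1) := rfl
  -- Downward induction from the zero tail, with `d` bounding the distance from degree `j + 1` to `n
  -- + 2`. Only terms of positive degree enter, so `K.X 0` is unconstrained.
  have hop (d : ℕ) : ∀ j, n + 2 ≤ j + 1 + d → ∀ I : A, Injective I → ∀ t, 1 ≤ t →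
      ExtVanishes (K.opcycles (j + 1)) (R.obj I) t := by
    induction d with
    | zero =>
      intro j hj I _ t _
      refine extVanishes_of_isZero ?_ _ _
      exact (hn j (by lia)).of_epi (K.pOpcycles (j + 1))
    | succ d ih =>
      intro j hj I hI t ht
      exact .left_first (K.shortExact_opcycles (hrel (j + 1)) (hK _)) (h _ I hI t ht)
        (ih _ (by lia) I hI _ (by lia))
  intro j
  refine HomologicalComplex.exactAt_of_extendsAlong _ (hrel j) fun I hI => ?_
  rw [HomologicalComplex.extendsAlong_map_iff adj,
    ← HomologicalComplex.extVanishes_opcycles_one_iff _ (hrel j) (hK _) (h j I hI 1 le_rfl)]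
  exact hop (n + 2) j (by lia) I hI 1 le_rfl

omit [EnoughProjectives B] [EnoughProjectives A] [Abelian A] [Abelian B] [L.Additive] in
lemma InAdd.map {X Z : B} (hZ : InAdd.{w} X Z) : InAdd.{w} (L.obj X) (L.obj Z) := by
  obtain ⟨J, c, ⟨hc⟩, ⟨r⟩⟩ := hZ
  have : PreservesColimitsOfSize.{w, w} L := adj.leftAdjoint_preservesColimits
  refine ⟨J, Cofan.mk _ fun a => L.map (c.inj a),
    ⟨isColimitCofanMkObjOfIsColimit L _ _ (hc.ofIsoColimit (Cofan.ext (Iso.refl _)))⟩, ⟨r.map L⟩⟩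

omit [EnoughProjectives A] in
lemma HasAddCoresolution.map [EnoughInjectives A] [EnoughInjectives B] {n : ℕ} {X P : B}
    (h : ∀ I : A, Injective I → ∀ t, 1 ≤ t → ExtVanishes X (R.obj I) t)
    (hP : HasAddCoresolution.{w} n X P) : HasAddCoresolution.{w} n (L.obj X) (L.obj P) := by
  obtain ⟨K, hK, ⟨e⟩, hadd, hzero⟩ := hP
  refine ⟨(L.mapHomologicalComplex _).obj K, ?_, ⟨L.mapIso e⟩, fun j hj => (hadd j hj).map adj,
    fun j hj => L.map_isZero (hzero j hj)⟩
  refine acyclic_map_of_extVanishes adj K hK hzero fun j I hI t ht => ?_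
  by_cases hj : j ≤ n
  · exact (hadd j hj).extVanishes ht (h I hI t ht)
  · exact extVanishes_of_isZero (hzero j (by lia)) _ _

end Complexes

lemma InAdd.of_iso {C : Type u} [Category.{v} C] {X X' Z : C} (e : X ≅ X')
    (h : InAdd.{w} X Z) : InAdd.{w} X' Z := by
  obtain ⟨J, c, ⟨hc⟩, hr⟩ := h
  refine ⟨J, Cofan.mk c.pt fun a => e.inv ≫ c.inj a, ⟨Cofan.IsColimit.mk _
    (fun s => Cofan.IsColimit.desc hc fun a => e.hom ≫ s.inj a) ?_ ?_⟩, hr⟩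
  · simp
  · intro s m hm
    refine Cofan.IsColimit.hom_ext hc _ _ fun a => ?_
    simp [← hm a]

lemma HasAddCoresolution.of_iso {C : Type u} [Category.{v} C] [Abelian C] {n : ℕ} {X X' P P' : C}
    (e : X ≅ X') (e' : P ≅ P') (h : HasAddCoresolution.{w} n X P) :
    HasAddCoresolution.{w} n X' P' := by
  obtain ⟨K, hK, ⟨e₀⟩, hadd, hzero⟩ := h
  exact ⟨K, hK, ⟨e₀ ≪≫ e'⟩, fun j hj => (hadd j hj).of_iso e, hzero⟩

/-! ### Comparing Ext over the two categories of a cleft extension. -/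

namespace CleftExtension

variable {B : Type u₁} [Category.{v₁} B] [Abelian B] {A : Type u₂} [Category.{v₂} A] [Abelian A]
  (E : CleftExtension B A)

lemma shortExact_counit (Y : A) :
    (ShortComplex.mk (E.ι.app Y) (E.adj.counit.app Y) (kernel.condition _)).ShortExact where
  exact := ShortComplex.exact_kernel _
  mono_f := E.mono_ι Y
  epi_g := inferInstanceAs (Epi (E.adj.counit.app Y))

/-- The exact sequence `0 → F X → e l e i X → e i X → 0`. -/
noncomputable def shortComplexF (X : B) : ShortComplex B :=
  (ShortComplex.mk (E.ι.app (E.i.obj X)) (E.adj.counit.app (E.i.obj X))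
    (kernel.condition _)).map E.e

lemma shortExact_F (X : B) : (E.shortComplexF X).ShortExact :=
  (E.shortExact_counit _).map_of_exact E.e

/-- The triangle identity makes the unit a section of `e` applied to the counit. -/
noncomputable def splittingF (X : B) : (E.shortComplexF X).Splitting :=
  .ofExactOfSection _ (E.shortExact_F X).exact (E.adj.unit.app (E.e.obj (E.i.obj X)))
    (E.adj.right_triangle_components _) (E.shortExact_F X).mono_f

noncomputable def isoX₂F (X : B) : (E.shortComplexF X).X₂ ≅ E.e.obj (E.l.obj X) :=
  E.e.mapIso (E.l.mapIso (E.iso.app X))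

noncomputable def isoX₃F (X : B) : (E.shortComplexF X).X₃ ≅ X := E.iso.app X

lemma extVanishes_e_l_iff [EnoughProjectives B] (Y X : B) (j : ℕ) :
    ExtVanishes Y (E.e.obj (E.l.obj X)) j ↔ ExtVanishes Y X j ∧ ExtVanishes Y (E.F.obj X) j := by
  have s := E.splittingF X
  constructor
  · intro h
    have h₂ := h.of_retract_right (E.isoX₂F X).retract
    exact ⟨(h₂.of_retract_right ⟨s.s, _, s.s_g⟩).of_retract_right (E.isoX₃F X).symm.retract,
      h₂.of_retract_right ⟨_, s.r, s.f_r⟩⟩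
  · rintro ⟨h₃, h₁⟩
    exact (ExtVanishes.right_middle (E.shortExact_F X) h₁
      (h₃.of_retract_right (E.isoX₃F X).retract)).of_retract_right (E.isoX₂F X).symm.retract

/-- The long exact homology sequence of 0 → F K → e l e i K → e i K → 0 gives exactness of e l K,
and `e` reflects it. -/
lemma exactAt_map_l {α : Type*} {c : ComplexShape α} (K : HomologicalComplex B c) {j : α}
    (hK : K.ExactAt j) (hF : ((E.F.mapHomologicalComplex c).obj K).ExactAt j) :
    ((E.l.mapHomologicalComplex c).obj K).ExactAt j := by
  have hF' : (((E.i ⋙ E.G ⋙ E.e).mapHomologicalComplex c).obj K).ExactAt j := hF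
  let f : E.i ⋙ E.G ⋙ E.e ⟶ E.i ⋙ (E.e ⋙ E.l) ⋙ E.e :=
    Functor.whiskerLeft E.i (Functor.whiskerRight E.ι E.e)
  let g : E.i ⋙ (E.e ⋙ E.l) ⋙ E.e ⟶ E.i ⋙ 𝟭 A ⋙ E.e :=
    Functor.whiskerLeft E.i (Functor.whiskerRight E.adj.counit E.e)
  let S : ShortComplex (HomologicalComplex B c) :=
    ShortComplex.mk ((NatTrans.mapHomologicalComplex f c).app K)
      ((NatTrans.mapHomologicalComplex g c).app K) (by
        ext k
        exact (E.shortComplexF (K.X k)).zero)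
  have hS : S.ShortExact := HomologicalComplex.shortExact_of_degreewise_shortExact S
    fun k => E.shortExact_F (K.X k)
  have h₃ : S.X₃.ExactAt j :=
    hK.of_iso ((NatIso.mapHomologicalComplex (E.iso.symm : 𝟭 B ≅ E.i ⋙ E.e) c).app K)
  have h₂ : S.X₂.ExactAt j := by
    rw [HomologicalComplex.exactAt_iff_isZero_homology] at hF' h₃ ⊢
    exact (hS.homology_exact₂ j).isZero_of_both_zeros (hF'.eq_of_src _ _) (h₃.eq_of_tgt _ _)
  have h : (((E.l ⋙ E.e).mapHomologicalComplex c).obj K).ExactAt j :=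
    h₂.of_iso ((NatIso.mapHomologicalComplex
      (Functor.isoWhiskerRight E.iso (E.l ⋙ E.e) :
        E.i ⋙ (E.e ⋙ E.l) ⋙ E.e ≅ E.l ⋙ E.e) c).app K)
  exact (ShortComplex.exact_map_iff_of_faithful
    (((E.l.mapHomologicalComplex c).obj K).sc j) E.e).1 h

lemma extVanishes_l_iff [EnoughProjectives B] [EnoughProjectives A] {X : B} {m : ℕ}
    (hX : ∀ t : ℕ, 1 ≤ t → t ≤ m → IsZero ((E.F.leftDerived t).obj X)) (Y : A) {t : ℕ}
    (ht : 1 ≤ t) (htm : t ≤ m) :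
    ExtVanishes (E.l.obj X) Y t ↔ ExtVanishes X (E.e.obj Y) t := by
  let P := projectiveResolution X
  refine extVanishes_leftAdjoint_iff E.adj P (fun j hj hjm => E.exactAt_map_l _ ?_ ?_) Y ht htm
  · obtain ⟨j, rfl⟩ := Nat.exists_eq_add_of_le' hj
    exact P.complex_exactAt_succ j
  · rw [HomologicalComplex.exactAt_iff_isZero_homology]
    exact (hX j hj hjm).of_iso (P.isoLeftDerivedObj E.F j).symm

/-! ### The functor `q` and the projectives of `A`. -/

instance preservesEpimorphisms_i : E.i.PreservesEpimorphisms where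
  preserves {X Y} f _ := by
    have : Epi (E.e.map (E.i.map f)) :=
      ((MorphismProperty.epimorphisms B).arrow_mk_iso_iff
        (((Functor.mapArrowFunctor _ _).mapIso E.iso).app (Arrow.mk f))).2 ‹Epi f›
    exact E.e.epi_of_epi_map this

noncomputable def adjQ : E.q ⊣ E.i := Adjunction.ofIsRightAdjoint E.i

noncomputable def lqIso : E.l ⋙ E.q ≅ 𝟭 B :=
  (E.adj.comp E.adjQ).leftAdjointUniq (Adjunction.id.ofNatIsoRight E.iso.symm)

instance additive_q : E.q.Additive := E.adjQ.left_adjoint_additive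

lemma isZero_q_obj {Y : A} (h : ∀ (Z : B) (f : Y ⟶ E.i.obj Z), f = 0) : IsZero (E.q.obj Y) := by
  rw [IsZero.iff_id_eq_zero]
  apply (E.adjQ.homEquiv _ _).injective
  rw [h _ (E.adjQ.homEquiv _ _ _), h _ (E.adjQ.homEquiv _ _ _)]

lemma projective_q_obj (Q : A) [Projective Q] : Projective (E.q.obj Q) :=
  E.adjQ.map_projective _ inferInstance

lemma projective_l_obj (P : B) [Projective P] : Projective (E.l.obj P) :=
  E.adj.map_projective _ inferInstance

/-- If `Ker q = 0`, every projective object of `A` is induced from `B`. -/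
lemma nonempty_iso_l_q (hq : E.KerQEqZero) (Q : A) [Projective Q] :
    Nonempty (E.l.obj (E.q.obj Q) ≅ Q) := by
  have := E.projective_q_obj Q
  have := E.projective_l_obj (E.q.obj Q)
  let u := E.adjQ.unit.app Q
  let p : E.l.obj (E.q.obj Q) ⟶ E.i.obj (E.q.obj Q) :=
    E.l.map (E.iso.inv.app _) ≫ E.adj.counit.app _
  have hp : Epi p := by
    have : Epi (E.adj.counit.app (E.i.obj (E.q.obj Q))) := inferInstance
    exact epi_comp _ _
  -- The transpose of `p` under `l ⊣ e` is the isomorphism `q Q ≅ e i q Q`, so every map to some `i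
  -- Z` factors through `p`.
  have hfac {Z : B} (h : E.l.obj (E.q.obj Q) ⟶ E.i.obj Z) :
      ∃ g : E.q.obj Q ⟶ Z, p ≫ E.i.map g = h := by
    refine ⟨E.adj.homEquiv _ _ h ≫ E.iso.hom.app Z, (E.adj.homEquiv _ _).injective ?_⟩
    have hn := E.iso.inv.naturality (E.adj.homEquiv _ _ h ≫ E.iso.hom.app Z)
    simp only [Functor.id_map, Functor.comp_map, Category.assoc] at hn
    rw [E.adj.homEquiv_naturality_right]
    have : E.adj.homEquiv _ _ p = E.iso.inv.app (E.q.obj Q) := by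
      simp [p, E.adj.homEquiv_unit]
    rw [this]
    exact hn.symm.trans
      ((congrArg _ (E.iso.hom_inv_id_app Z)).trans (Category.comp_id _))
  have hu {Z : B} (g : E.q.obj Q ⟶ Z) (hg : u ≫ E.i.map g = 0) : g = 0 := by
    apply (E.adjQ.homEquiv _ _).injective
    simp only [E.adjQ.homEquiv_unit, E.i.map_zero, comp_zero]
    exact hg
  let φ : Q ⟶ E.l.obj (E.q.obj Q) := Projective.factorThru u p
  have hφ : φ ≫ p = u := Projective.factorThru_comp _ _
  have hepi : Epi φ := by
    -- A map from the cokernel to `i Z` yields `g` with `p ≫ i g` killed by `φ`; since `φ ≫ p` is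
    -- the unit, `g = 0`.
    refine Preadditive.epi_of_isZero_cokernel _ (hq _ (E.isZero_q_obj fun Z f => ?_))
    rw [← cancel_epi (cokernel.π φ), comp_zero]
    obtain ⟨g, hg⟩ := hfac (cokernel.π φ ≫ f)
    rw [← hg, hu g, E.i.map_zero, comp_zero]
    rw [← hφ, Category.assoc, hg, cokernel.condition_assoc, zero_comp]
  obtain ⟨s, hs⟩ : ∃ s, s ≫ φ = 𝟙 _ := ⟨_, Projective.factorThru_comp (𝟙 _) φ⟩
  have hmono : Mono φ := by
    -- The section `s` makes the kernel a summand of `Q`. A map from it to `i Z` extends to `Q`,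
    -- hence factors through the unit `φ ≫ p` and dies on the kernel.
    refine Preadditive.mono_of_isZero_kernel _ (hq _ (E.isZero_q_obj fun Z f => ?_))
    let r : Q ⟶ kernel φ := kernel.lift φ (𝟙 Q - φ ≫ s) (by simp [hs])
    have hr : kernel.ι φ ≫ r = 𝟙 _ := by
      simp [← cancel_mono (kernel.ι φ), r, Preadditive.comp_sub]
    have hf : r ≫ f = φ ≫ p ≫ E.i.map ((E.adjQ.homEquiv _ _).symm (r ≫ f)) := by
      rw [reassoc_of% hφ, ← E.adjQ.homEquiv_unit]
      simp
    rw [← Category.id_comp f, ← hr, Category.assoc, hf, kernel.condition_assoc, zero_comp]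
  have : IsIso φ := isIso_of_mono_of_epi φ
  exact ⟨(asIso φ).symm⟩

end CleftExtension

/-! ### Transfer of the tilting conditions. -/

namespace CleftExtension

variable {B : Type u₁} [Category.{v₁} B] [Abelian B] [EnoughProjectives B] [EnoughInjectives B]
  {A : Type u₂} [Category.{v₂} A] [Abelian A] [EnoughProjectives A] [EnoughInjectives A]
  (E : CleftExtension B A) {n : ℕ} {X : B}
  (hX : ∀ t : ℕ, 1 ≤ t → t ≤ n + 1 → IsZero ((E.F.leftDerived t).obj X))
include hX

lemma projectiveDimension_l_le_iff :
    projectiveDimension (E.l.obj X) ≤ n ↔ projectiveDimension X ≤ n := by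
  simp only [projectiveDimension_le_iff_extVanishes,
    E.extVanishes_l_iff hX _ (Nat.le_add_left 1 n) le_rfl]
  exact ⟨fun h Y => (h (E.i.obj Y)).of_retract_right (E.iso.app Y).symm.retract, fun h Y => h _⟩

lemma isPartialTilting_l_iff :
    IsPartialTilting n (E.l.obj X) ↔ IsPartialTilting n X ∧ InPerp X n (E.F.obj X) := by
  have hext {j : ℕ} (hj : 1 ≤ j) (hjn : j ≤ n) : ExtVanishes (E.l.obj X) (E.l.obj X) j ↔
      ExtVanishes X X j ∧ ExtVanishes X (E.F.obj X) j := by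
    rw [E.extVanishes_l_iff hX _ hj (by lia), extVanishes_e_l_iff]
  constructor
  · intro h
    have hpd := (E.projectiveDimension_l_le_iff hX).1 h.pd_le
    refine ⟨⟨hpd, fun j hj => ?_⟩, fun j hj hjn => ((hext hj hjn).1 (h.ext_self j hj)).2⟩
    by_cases hjn : j ≤ n
    · exact ((hext hj hjn).1 (h.ext_self j hj)).1
    · exact extVanishes_of_projectiveDimension_le hpd _ (by lia)
  · rintro ⟨h, hF⟩
    have hpd := (E.projectiveDimension_l_le_iff hX).2 h.pd_le
    refine ⟨hpd, fun j hj => ?_⟩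
    by_cases hjn : j ≤ n
    · exact (hext hj hjn).2 ⟨h.ext_self j hj, hF j hj hjn⟩
    · exact extVanishes_of_projectiveDimension_le hpd _ (by lia)

lemma hasAddCoresolution_of_l (hpd : projectiveDimension X ≤ n) {P : B}
    (hP : HasAddCoresolution.{w} n (E.l.obj X) (E.l.obj P)) : HasAddCoresolution.{w} n X P := by
  refine (hP.map E.adjQ fun I hI t ht => ?_).of_iso (E.lqIso.app X) (E.lqIso.app P)
  by_cases htn : t ≤ n
  · rw [E.extVanishes_l_iff hX _ ht (by lia)]
    exact (extVanishes_of_injective X I ht).of_retract_right (E.iso.app I).retract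
  · exact extVanishes_of_projectiveDimension_le ((E.projectiveDimension_l_le_iff hX).2 hpd) _
      (by lia)

/-- `e I` need not be injective, but Ext^t(X, e I) vanishes with Ext^t(l X, I) for `t ≤ n`, and by
projective dimension beyond. -/
lemma hasAddCoresolution_l (hpd : projectiveDimension X ≤ n) {P : B}
    (hP : HasAddCoresolution.{w} n X P) : HasAddCoresolution.{w} n (E.l.obj X) (E.l.obj P) := by
  refine hP.map E.adj fun I hI t ht => ?_
  by_cases htn : t ≤ n
  · rw [← E.extVanishes_l_iff hX _ ht (by lia)]
    exact extVanishes_of_injective _ I ht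
  · exact extVanishes_of_projectiveDimension_le hpd _ (by lia)

lemma isTilting_l_iff (hq : E.KerQEqZero) :
    IsTilting.{w} n (E.l.obj X) ↔ IsTilting.{w} n X ∧ InPerp X n (E.F.obj X) := by
  constructor
  · intro h
    obtain ⟨hpt, hF⟩ := (E.isPartialTilting_l_iff hX).1 h.toIsPartialTilting
    exact ⟨⟨hpt, fun P _ => E.hasAddCoresolution_of_l hX hpt.pd_le
      (h.coresolution _ (E.projective_l_obj P))⟩, hF⟩
  · rintro ⟨h, hF⟩
    refine ⟨(E.isPartialTilting_l_iff hX).2 ⟨h.toIsPartialTilting, hF⟩, fun Q _ => ?_⟩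
    obtain ⟨e⟩ := E.nonempty_iso_l_q hq Q
    exact (E.hasAddCoresolution_l hX h.pd_le
      (h.coresolution _ (E.projective_q_obj Q))).of_iso (Iso.refl _) e

end CleftExtension

theorem theorem3p5 {B : Type u₁} [Category.{v₁} B] [Abelian B] [EnoughProjectives B]
    [EnoughInjectives B] {A : Type u₂} [Category.{v₂} A] [Abelian A] [EnoughProjectives A]
    [EnoughInjectives A] (E : CleftExtension B A) (n : ℕ) (X : B)
    (hX : ∀ t : ℕ, 1 ≤ t → t ≤ n + 1 → IsZero ((E.F.leftDerived t).obj X)) :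
    (IsPartialTilting n (E.l.obj X) ↔ IsPartialTilting n X ∧ InPerp X n (E.F.obj X)) ∧
    (E.KerQEqZero →
      (IsTilting.{w} n (E.l.obj X) ↔ IsTilting.{w} n X ∧ InPerp X n (E.F.obj X))) :=
  ⟨E.isPartialTilting_l_iff hX, E.isTilting_l_iff hX⟩
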